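/- Let $n\ge 0$, $k\ge 2$ and $V=[n]$. Let $(k+1)^V$ be the set of $k$-tuples $\boldsymbol x=(X_1,\dots,X_k)$ of pairwise disjoint subsets of $V$, with $\operatorname{supp}(\boldsymbol x)=X_1\cup\dots\cup X_k$. Call $f:(k+1)^V\to\mathbb R$ $k$-submodular if $f(\boldsymbol x)+f(\boldsymbol y)\ge f(\boldsymbol x\sqcup\boldsymbol y)+f(\boldsymbol x\sqcap\boldsymbol y)$ for all $\boldsymbol x,\boldsymbol y$, where $\boldsymbol x\sqcap\boldsymbol y=(X_i\cap Y_i)_{i}$ and $\boldsymbol x\sqcup\boldsymbol y=\big((X_i\cup Y_i)\setminus\bigcup_{j\ne i}(X_j\cup Y_j)\big)_{i}$. Let $(V,\mathcal F)$ be a matroid of rank $M$; call $\boldsymbol x$ feasible if $\operatorname{supp}(\boldsymbol x)\in\mathcal F$. Online problem. Over $T$ rounds a learner plays feasible actions $A_1,\dots,A_T\in(k+1)^V$ and after round $t$ observes only the reward $f_t(A_t)$. The random reward functions $f_t:(k+1)^V\to[0,1]$ are i.i.d. over $t$, and their expectation $f(\boldsymbol x)=\mathbb E[f_t(\boldsymbol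 x)]$ is $k$-submodular (not necessarily monotone). The expected cumulative $1/3$-regret is $$\mathbb E[\mathcal R_T]=\tfrac13\,T\max_{\boldsymbol x\text{ feasible}}f(\boldsymbol x)-\mathbb E\Big[\sum_{t=1}^T f_t(A_t)\Big].$$ Greedy algorithm. Start with $\boldsymbol s=(\emptyset,\dots,\emptyset)$. In each of $M$ iterations, query the value oracle at all solutions obtained from $\boldsymbol s$ by assigning a type $i\in[k]$ to an element $e\notin\operatorname{supp}(\boldsymbol s)$ with $\operatorname{supp}(\boldsymbol s)\cup\{e\}\in\mathcal F$, and replace $\boldsymbol s$ by one of largest value, i.e. of largest marginal gain (queries in any order, ties broken by any fixed rule). Output $\boldsymbol s$. C-ETC with the greedy algorithm. Put $\delta=\tfrac43(M+1)$, $N=nkM$ and $m=\Big\lceil\frac{\delta^{2/3}T^{2/3}\log(T)^{1/3}}{2N^{2/3}}\Big\rceil$ (if $N=0$ no query is made and the value of $m$ is irrelevant). Run the greedy algorithm; whenever it queries an action, play this action $m$ times and return the empirical mean of the observed rewards as the oracle's answer. In all remaining rounds play the greedy algorithm's output. (Play ends after round $T$, even if exploration is not finished.) Then there is an absolute constant $C$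 such that, for all such $n,k,M$, matroids, reward distributions, query orders and tie-breaking rules, and for every integer $T\ge nk\max\Big\{1,\frac{3\sqrt2\,M}{2(M+1)}\Big\}$, the policy C-ETC with the greedy algorithm satisfies $$\mathbb E[\mathcal R_T]\le C\,n^{1/3}k^{1/3}M\,T^{2/3}\log(T)^{1/3}.$$ -/

import Mathlib

open MeasureTheory ProbabilityTheory

noncomputable section

/-! ### `k`-submodular functions -/

/-- The set `(k+1)^V` for `V = [n]`: each element of `V` receives at most one of the `k` types
(`none` means unassigned).  The tuple `(X₁, …, X_k)` of disjoint sets attached to `x` is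
`fun i => typeSet x i`. -/
abbrev PartialAssignment (n k : ℕ) := Fin n → Option (Fin k)

namespace PartialAssignment

variable {n k : ℕ}

/-- The set `X_i` of elements that are assigned type `i`. -/
def typeSet (x : PartialAssignment n k) (i : Fin k) : Set (Fin n) := {e | x e = some i}

/-- The support of `x`: the elements that are assigned some type. -/
def supp (x : PartialAssignment n k) : Set (Fin n) := {e | x e ≠ none}

/-- The operation `x ⊓ y = (X₁ ∩ Y₁, …, X_k ∩ Y_k)`; see `typeSet_meet`. -/
def meet (x y : PartialAssignment n k) : PartialAssignment n k :=
  fun e => if x e = y e then x e else none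

/-- The operation `x ⊔ y`, whose `i`-th set is `(X_i ∪ Y_i) \ ⋃_{j ≠ i} (X_j ∪ Y_j)`;
see `typeSet_join`. -/
def join (x y : PartialAssignment n k) : PartialAssignment n k :=
  fun e => if x e = none then y e
    else if y e = none then x e
    else if x e = y e then x e
    else none

theorem typeSet_injective :
    Function.Injective (typeSet : PartialAssignment n k → Fin k → Set (Fin n)) := by
  intro x y h
  funext e
  have h' : ∀ i, x e = some i ↔ y e = some i := fun i => by
    have := congrArg (fun S : Set (Fin n) => e ∈ S) (congrFun h i)
    simpa [typeSet] using this
  exact Option.ext h'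

theorem typeSet_meet (x y : PartialAssignment n k) (i : Fin k) :
    typeSet (meet x y) i = typeSet x i ∩ typeSet y i := by
  ext e
  simp only [typeSet, meet, Set.mem_ofPred_eq, Set.mem_inter_iff]
  rcases hx : x e with _ | a <;> rcases hy : y e with _ | b <;> simp
  grind

theorem typeSet_join (x y : PartialAssignment n k) (i : Fin k) :
    typeSet (join x y) i =
      (typeSet x i ∪ typeSet y i) \ ⋃ j ∈ {j : Fin k | j ≠ i}, (typeSet x j ∪ typeSet y j) := by
  ext e
  simp only [typeSet, join, Set.mem_ofPred_eq, Set.mem_union, Set.mem_sdiff, Set.mem_iUnion]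
  rcases hx : x e with _ | a <;> rcases hy : y e with _ | b <;> simp
  all_goals grind

/-- The assignment obtained from `x` by giving the element `p.1` the type `p.2`. -/
def assign (x : PartialAssignment n k) (p : Fin n × Fin k) : PartialAssignment n k :=
  Function.update x p.1 (some p.2)

/-- `k`-submodularity of `f : (k+1)^V → ℝ`. -/
def IsKSubmodular (f : PartialAssignment n k → ℝ) : Prop :=
  ∀ x y, f (join x y) + f (meet x y) ≤ f x + f y

/-- Feasibility under a matroid constraint: the support is an independent set. -/
def Feasible (𝓜 : Matroid (Fin n)) (x : PartialAssignment n k) : Prop :=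
  𝓜.Indep (supp x)

end PartialAssignment

/-! ### Offline algorithms with a value oracle -/

/-- A deterministic offline algorithm that interacts with a value oracle for a real function on
`A`: it either stops and outputs an element of `A`, or queries the value of an element of `A` and
continues depending on the answer. -/
inductive OracleAlgorithm (A : Type) : Type
  | output : A → OracleAlgorithm A
  | query : A → (ℝ → OracleAlgorithm A) → OracleAlgorithm A

namespace OracleAlgorithm

/-- Query the values of `act p` for all `p` in a list, one after the other, record the answers
in the table `v`, and continue with the completed table. -/
def queryEach {A ι : Type} [DecidableEq ι] (act : ι → A) :
    List ι → ((ι → ℝ) → OracleAlgorithm A) → (ι → ℝ) → OracleAlgorithm A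
  | [], next, v => next v
  | p :: L, next, v => query (act p) fun y => queryEach act L next (Function.update v p y)

end OracleAlgorithm

/-! ### The greedy algorithm for a matroid constraint -/

/-- The choices that the description of the greedy algorithm leaves open: the order in which the
element-type pairs are examined, and the rule that breaks ties in the `argmax`; both may depend on
the current solution. -/
structure GreedyChoices (n k : ℕ) where
  order : PartialAssignment n k → List (Fin n × Fin k)
  order_nodup : ∀ s, (order s).Nodup
  mem_order : ∀ s p, p ∈ order s
  pick : PartialAssignment n k → (S : Finset (Fin n × Fin k)) → S.Nonempty → Fin n × Fin k
  pick_mem : ∀ s S hS, pick s S hS ∈ S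

namespace MatroidGreedy

variable {n k : ℕ}

/-- The set `E(s)` of available elements. -/
def available (𝓜 : Matroid (Fin n)) (s : PartialAssignment n k) : Set (Fin n) :=
  {e | e ∉ s.supp ∧ 𝓜.Indep (insert e s.supp)}

open Classical in
/-- The pairs `(e, i)` with `e ∈ E(s)`, in the order in which they are examined. -/
def candidates (𝓜 : Matroid (Fin n)) (c : GreedyChoices n k) (s : PartialAssignment n k) :
    List (Fin n × Fin k) :=
  (c.order s).filter fun p => p.1 ∈ available 𝓜 s

open Classical in
/-- The candidate pairs of largest marginal gain, where `v p` is the oracle's value of the solution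
`s` extended by `p`.  As the gain of `p` is `v p` minus the value of `s`, which does not depend on
`p`, the largest gains are attained where `v` is largest. -/
def maximizers (L : List (Fin n × Fin k)) (v : Fin n × Fin k → ℝ) : Finset (Fin n × Fin k) :=
  L.toFinset.filter fun p => ∀ q ∈ L, v q ≤ v p

open Classical in
/-- The greedy algorithm, with `r` iterations left and current solution `s`.  (If there is no
candidate pair it stops; this does not occur while `s` has fewer elements than the rank.) -/
def run (𝓜 : Matroid (Fin n)) (c : GreedyChoices n k) :
    ℕ → PartialAssignment n k → OracleAlgorithm (PartialAssignment n k)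
  | 0, s => .output s
  | r + 1, s =>
    OracleAlgorithm.queryEach s.assign (candidates 𝓜 c s)
      (fun v =>
        if hS : (maximizers (candidates 𝓜 c s) v).Nonempty then
          run 𝓜 c r (s.assign (c.pick s (maximizers (candidates 𝓜 c s) v) hS))
        else .output s)
      0

/-- The matroid greedy algorithm: `M` iterations (`M` being the rank), starting from the empty
solution. -/
def algorithm (𝓜 : Matroid (Fin n)) (c : GreedyChoices n k) (M : ℕ) :
    OracleAlgorithm (PartialAssignment n k) :=
  run 𝓜 c M fun _ => none

end MatroidGreedy

/-! ### The online problem and C-ETC -/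

/-- A deterministic bandit policy with full-bandit feedback: it chooses the next action from the
list of the rewards received so far (which determine the actions played so far). -/
abbrev BanditPolicy (A : Type) := List ℝ → A

namespace BanditPolicy

variable {A : Type}

/-- The rewards received in the first `t` rounds by the policy `π`, if the reward of action `a`
in round `j` is `F j a`. -/
def history (π : BanditPolicy A) (F : ℕ → A → ℝ) : ℕ → List ℝ
  | 0 => []
  | t + 1 => history π F t ++ [F t (π (history π F t))]

/-- The action played by the policy `π` in round `t` (rounds are numbered from `0`). -/
def action (π : BanditPolicy A) (F : ℕ → A → ℝ) (t : ℕ) : A := π (history π F t)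

/-- The expected cumulative `α`-regret over `T` rounds, `α T f(OPT) - 𝔼[∑_{t < T} f_t(A_t)]`,
where `OPT` maximizes `f` over the feasible set `D`. -/
def expectedRegret {Ω : Type*} [MeasurableSpace Ω] (μ : Measure Ω) (α : ℝ) (D : Set A)
    (f : A → ℝ) (F : ℕ → Ω → A → ℝ) (T : ℕ) (π : BanditPolicy A) : ℝ :=
  α * T * sSup (f '' D)
    - ∫ ω, ∑ t ∈ Finset.range T, F t ω (action π (fun j => F j ω) t) ∂μ

end BanditPolicy

namespace CETC

/-- Explore-then-commit around an offline algorithm: each action that the algorithm queries is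
played `m` times and the empirical mean of the rewards is returned as the oracle's answer; the
algorithm's output is played in all remaining rounds. -/
def policy {A : Type} (m : ℕ) : OracleAlgorithm A → BanditPolicy A
  | .output S, _ => S
  | .query a next, h =>
    if h.length < m then a
    else policy m (next ((h.take m).sum / m)) (h.drop m)

/-- The number `m` of times that each queried action is played. -/
def explorationLength (δ N T : ℝ) : ℕ :=
  ⌈δ ^ (2 / 3 : ℝ) * T ^ (2 / 3 : ℝ) * Real.log T ^ (1 / 3 : ℝ) / (2 * N ^ (2 / 3 : ℝ))⌉₊

/-- C-ETC with horizon `T`, using an offline algorithm with robustness parameter `δ` and at most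
`N` queries. -/
def cetc {A : Type} (δ N : ℝ) (T : ℕ) (alg : OracleAlgorithm A) : BanditPolicy A :=
  policy (explorationLength δ N T) alg

end CETC

/-- The stochastic rewards: `F t ω a` is the reward `f_t(a)` of action `a` in round `t`.  The
reward functions `f_0, f_1, …` are i.i.d., take values in `[0, 1]`, and have expectation `f`. -/
structure IsStochasticReward {Ω A : Type*} [MeasurableSpace Ω] (μ : Measure Ω)
    (F : ℕ → Ω → A → ℝ) (f : A → ℝ) : Prop where
  measurable : ∀ t, Measurable (F t)
  indep : iIndepFun F μ
  identDistrib : ∀ t, IdentDistrib (F t) (F 0) μ μ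
  mem_Icc : ∀ t ω a, F t ω a ∈ Set.Icc (0 : ℝ) 1
  expectation : ∀ a, f a = ∫ ω, F 0 ω a ∂μ

end

/-! Offline, greedy tolerates an inexact oracle. Alongside the greedy solution `s` keep a solution
`o` that extends `s` and is supported on a base, starting from an optimum. When greedy adds `(e,
i)`, matroid exchange lets `e` replace some `x` of `o` outside `s`. Removing `x` costs its gain,
which by diminishing gains is at most its gain at `s`. Inserting `(e, i)` costs at most the gain of
`e` with another type, because two types at one element have nonnegative total gain. Greedy
preferred its own pair to both alternatives, so `f o + 2 * f s` drops by at most `4ε` per iteration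
(`exists_exchange`, `guarantees_run`). At the end `s = o`, which together with `f ≥ 0` gives the
ratio `1/3` with error `4/3 * M * ε`.

Online, the action explored in a block is determined by earlier rewards, hence is independent of the
rewards in the block. Hoeffding's inequality thus applies to each block and a union bound to all `Q
= n * k * M` of them. Exploration costs at most `Q * m`; each later round costs the offline error
plus the failure probability (`expectedRegret_le`). With `ε = √(log T / m)` the failure probability
is at most `2 * Q / T ^ 2`, and the chosen `m` balances exploration against the offline error
(`regret_arith`). -/

/-! ### Orthant submodularity and pairwise monotonicity -/

namespace PartialAssignment

variable {n k : ℕ}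

/-- `x` is a restriction of `y`: every element assigned by `x` has the same type in `y`. -/
def Restricts (x y : PartialAssignment n k) : Prop := ∀ e, x e = none ∨ x e = y e

theorem Restricts.supp_subset {x y : PartialAssignment n k} (h : Restricts x y) :
    x.supp ⊆ y.supp := by
  intro e he
  rcases h e with h | h
  · exact absurd h he
  · exact fun h' => he (h.trans h')

theorem Restricts.eq_of_supp_subset {x y : PartialAssignment n k} (h : Restricts x y)
    (hs : y.supp ⊆ x.supp) : x = y := by
  funext e
  rcases h e with h' | h'
  · by_contra hne
    exact hs (a := e) (fun hy => hne (h'.trans hy.symm)) h'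
  · exact h'

theorem Restricts.assign {x y : PartialAssignment n k} (h : Restricts x y)
    (p : Fin n × Fin k) : Restricts (x.assign p) (y.assign p) := by
  intro e
  by_cases he : e = p.1
  · right; simp [PartialAssignment.assign, he]
  · simpa [PartialAssignment.assign, Function.update_of_ne he] using h e

theorem supp_assign (x : PartialAssignment n k) (p : Fin n × Fin k) :
    (x.assign p).supp = insert p.1 x.supp := by
  ext e
  by_cases he : e = p.1 <;> simp [supp, assign, he]

/-- Marginal gains decrease along restrictions. -/
theorem IsKSubmodular.gain_le_gain {f : PartialAssignment n k → ℝ} (hf : IsKSubmodular f)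
    {x y : PartialAssignment n k} (h : Restricts x y) {p : Fin n × Fin k} (hp : p.1 ∉ y.supp) :
    f (y.assign p) - f y ≤ f (x.assign p) - f x := by
  have hy : y p.1 = none := by simpa [supp] using hp
  have hx : x p.1 = none := by rcases h p.1 with h | h <;> simp [h, hy]
  have hj : join (x.assign p) y = y.assign p := by
    funext e
    by_cases he : e = p.1
    · subst he; simp [join, assign, hy]
    · have := h e
      simp only [join, assign, Function.update_of_ne he]
      grind
  have hm : meet (x.assign p) y = x := by
    funext e
    by_cases he : e = p.1
    · subst he; simp [meet, assign, hy, hx]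
    · have := h e
      simp only [meet, assign, Function.update_of_ne he]
      grind
  have := hf (x.assign p) y
  rw [hj, hm] at this
  linarith

/-- The gains of two different types at the same element have nonnegative sum. -/
theorem IsKSubmodular.pairwise_monotone {f : PartialAssignment n k → ℝ} (hf : IsKSubmodular f)
    {x : PartialAssignment n k} {e : Fin n} (he : e ∉ x.supp) {i j : Fin k} (hij : i ≠ j) :
    0 ≤ (f (x.assign (e, i)) - f x) + (f (x.assign (e, j)) - f x) := by
  have hx : x e = none := by simpa [supp] using he
  have hj : join (x.assign (e, i)) (x.assign (e, j)) = x := by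
    funext a
    by_cases ha : a = e
    · subst ha; simp [join, assign, hx, hij]
    · simp only [join, assign, Function.update_of_ne ha]; grind
  have hm : meet (x.assign (e, i)) (x.assign (e, j)) = x := by
    funext a
    by_cases ha : a = e
    · subst ha; simp [meet, assign, hx, hij]
    · simp only [meet, assign, Function.update_of_ne ha]; grind
  have := hf (x.assign (e, i)) (x.assign (e, j))
  rw [hj, hm] at this
  linarith

theorem exists_type_ne (hk : 2 ≤ k) (i : Fin k) : ∃ j : Fin k, i ≠ j := by
  have : Nontrivial (Fin k) := Fin.nontrivial_iff_two_le.2 hk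
  obtain ⟨j, hj⟩ := exists_ne i
  exact ⟨j, hj.symm⟩

/-- Every feasible solution extends to a solution of no smaller value supported on a base. -/
theorem IsKSubmodular.exists_isBase_supp {f : PartialAssignment n k → ℝ} (hf : IsKSubmodular f)
    (hk : 2 ≤ k) {𝓜 : Matroid (Fin n)} {x : PartialAssignment n k} (hx : Feasible 𝓜 x) :
    ∃ y : PartialAssignment n k, 𝓜.IsBase y.supp ∧ f x ≤ f y := by
  -- Take a maximal support among all feasible solutions at least as good as `x`. If it could grow
  -- by `e`, every type at `e` would strictly lower the value, against pairwise monotonicity.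
  obtain ⟨y, ⟨hy, hxy⟩, hmax⟩ := (Set.toFinite {y : PartialAssignment n k |
    Feasible 𝓜 y ∧ f x ≤ f y}).exists_maximalFor (fun y => y.supp) _ ⟨x, hx, le_rfl⟩
  refine ⟨y, ?_, hxy⟩
  by_contra hb
  obtain ⟨B, hB, hyB⟩ := hy.exists_isBase_superset
  obtain ⟨e, heB, hey⟩ : ∃ e ∈ B, e ∉ y.supp := by
    by_contra! h
    exact hb (by rwa [Set.Subset.antisymm hyB h])
  let i : Fin k := ⟨0, by omega⟩
  obtain ⟨j, hij⟩ := exists_type_ne hk i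
  have key : ∀ l : Fin k, f (y.assign (e, l)) < f y := by
    intro l
    by_contra! hl
    have hs := supp_assign y (e, l)
    have := hmax (j := y.assign (e, l))
      ⟨by rw [Feasible, hs]; exact hB.indep.subset (Set.insert_subset heB hyB), hxy.trans hl⟩
      (by simp only [hs]; exact Set.subset_insert _ _)
    simp only [hs] at this
    exact hey (this (Set.mem_insert _ _))
  linarith [hf.pairwise_monotone hey hij, key i, key j]

end PartialAssignment

/-- If `e ∈ O`, take `x = e`. Otherwise extend `insert e S` to a base inside `insert e O`; it misses
some `x ∈ O`, and `e` is the only element that can replace `x`. -/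
theorem Matroid.IsBase.exists_exchange_of_indep_insert {α : Type*} {𝓜 : Matroid α} {O S : Set α}
    {e : α} (hO : 𝓜.IsBase O) (hSO : S ⊆ O) (he : e ∉ S) (hi : 𝓜.Indep (insert e S)) :
    ∃ x ∈ O, x ∉ S ∧ e ∉ O \ {x} ∧ 𝓜.IsBase (insert e (O \ {x})) := by
  by_cases heO : e ∈ O
  · refine ⟨e, heO, he, by simp, ?_⟩
    rwa [Set.insert_sdiff_singleton, Set.insert_eq_of_mem heO]
  · obtain ⟨B, hB, hSB, hBO⟩ := hi.exists_isBase_subset_union_isBase hO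
    have heB : e ∈ B := hSB (Set.mem_insert _ _)
    have hsub : B ⊆ insert e O := by
      refine hBO.trans ?_
      rintro a ((rfl | ha) | ha)
      · exact Set.mem_insert _ _
      · exact Set.mem_insert_of_mem _ (hSO ha)
      · exact Set.mem_insert_of_mem _ ha
    obtain ⟨x, hx, hxB⟩ : ∃ x ∈ O, x ∉ B := by
      by_contra! h
      exact heO (by rw [hO.eq_of_subset_isBase hB h]; exact heB)
    have hxS : x ∉ S := fun h => hxB (hSB (Set.mem_insert_of_mem _ h))
    refine ⟨x, hx, hxS, fun h => heO h.1, ?_⟩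
    obtain ⟨y, hy, hby⟩ := hO.exchange hB ⟨hx, hxB⟩
    have : y = e := by
      rcases hsub hy.1 with h | h
      · exact h
      · exact absurd h hy.2
    rwa [this] at hby

/-! ### Guarantees of an offline algorithm under an approximate oracle -/

namespace OracleAlgorithm

/-- If the oracle answers every query `a` by a value within `ε` of `f a`, then the algorithm makes
at most `Q` queries and its output satisfies `P`. -/
def Guarantees {A : Type} (f : A → ℝ) (ε : ℝ) (P : A → Prop) : OracleAlgorithm A → ℕ → Prop
  | output S, _ => P S
  | query _ _, 0 => False
  | query a next, Q + 1 => ∀ y, |y - f a| ≤ ε → Guarantees f ε P (next y) Q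

variable {A : Type} {f : A → ℝ} {ε : ℝ} {P P' : A → Prop}

theorem Guarantees.mono (hP : ∀ S, P S → P' S) :
    ∀ {alg : OracleAlgorithm A} {Q Q' : ℕ}, Guarantees f ε P alg Q → Q ≤ Q' →
      Guarantees f ε P' alg Q'
  | output S, _, _, h, _ => hP S h
  | query _ _, 0, _, h, _ => h.elim
  | query _ _, _ + 1, 0, _, hQ => by omega
  | query _ _, _ + 1, _ + 1, h, hQ => fun y hy => (h y hy).mono hP (by omega)

/-- Induction on the list. As it has no duplicates, a recorded answer is never overwritten; the
condition off `L` carries the earlier answers through the recursion. -/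
theorem guarantees_queryEach {ι : Type} [DecidableEq ι] (act : ι → A)
    (next : (ι → ℝ) → OracleAlgorithm A) (Q : ℕ) :
    ∀ (L : List ι) (v : ι → ℝ), L.Nodup →
      (∀ w : ι → ℝ, (∀ p ∈ L, |w p - f (act p)| ≤ ε) → (∀ p ∉ L, w p = v p) →
        Guarantees f ε P (next w) Q) →
      Guarantees f ε P (queryEach act L next v) (L.length + Q)
  | [], v, _, h => by simpa [queryEach] using h v (by simp) (by simp)
  | p :: L, v, hL, h => by
    rw [List.nodup_cons] at hL
    rw [List.length_cons, Nat.add_right_comm]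
    intro y hy
    refine guarantees_queryEach act next Q L _ hL.2 fun w hw hw' => h w ?_ ?_
    · intro q hq
      rcases List.mem_cons.1 hq with rfl | hq
      · rw [hw' _ hL.1, Function.update_self]; exact hy
      · exact hw q hq
    · intro q hq
      rw [List.mem_cons, not_or] at hq
      rw [hw' q hq.2, Function.update_of_ne hq.1]

end OracleAlgorithm

/-! ### The greedy algorithm with an approximate oracle -/

namespace MatroidGreedy

open PartialAssignment

variable {n k : ℕ} {𝓜 : Matroid (Fin n)} {c : GreedyChoices n k}

theorem mem_candidates {s : PartialAssignment n k} {p : Fin n × Fin k} :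
    p ∈ candidates 𝓜 c s ↔ p.1 ∉ s.supp ∧ 𝓜.Indep (insert p.1 s.supp) := by
  classical
  rw [candidates, List.mem_filter, decide_eq_true_iff]
  exact and_iff_right (c.mem_order s p)

theorem nodup_candidates (s : PartialAssignment n k) : (candidates 𝓜 c s).Nodup :=
  (c.order_nodup s).filter _

theorem length_candidates_le (s : PartialAssignment n k) :
    (candidates 𝓜 c s).length ≤ n * k := by
  simpa using (nodup_candidates (𝓜 := 𝓜) (c := c) s).length_le_card

theorem maximizers_nonempty {L : List (Fin n × Fin k)} (hL : L ≠ [])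
    (v : Fin n × Fin k → ℝ) : (maximizers L v).Nonempty := by
  classical
  obtain ⟨p, hp, hmax⟩ := L.toFinset.exists_max_image v (by simpa using hL)
  exact ⟨p, by simpa [maximizers] using ⟨by simpa using hp, fun a b h => hmax (a, b) (by simpa using h)⟩⟩

theorem mem_maximizers {L : List (Fin n × Fin k)} {v : Fin n × Fin k → ℝ} {p : Fin n × Fin k} :
    p ∈ maximizers L v ↔ p ∈ L ∧ ∀ q ∈ L, v q ≤ v p := by
  simp [maximizers]

/-- One step of the exchange argument: adding a pair of largest gain up to `η` to `s` decreases
the value of a suitable solution above `s` by at most twice the gain, up to `2 * η`. -/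
theorem exists_exchange {f : PartialAssignment n k → ℝ} (hf : IsKSubmodular f) (hk : 2 ≤ k)
    {s o : PartialAssignment n k} (ho : 𝓜.IsBase o.supp) (hso : Restricts s o)
    {p : Fin n × Fin k} (hp : p ∈ candidates 𝓜 c s) {η : ℝ}
    (hmax : ∀ q ∈ candidates 𝓜 c s, f (s.assign q) ≤ f (s.assign p) + η) :
    ∃ o' : PartialAssignment n k, 𝓜.IsBase o'.supp ∧ Restricts (s.assign p) o' ∧
      f o ≤ f o' + 2 * (f (s.assign p) - f s) + 2 * η := by
  obtain ⟨e, i⟩ := p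
  obtain ⟨hes, hei⟩ := mem_candidates.1 hp
  obtain ⟨x, hxO, hxS, heO, hB⟩ :=
    ho.exists_exchange_of_indep_insert hso.supp_subset hes hei
  obtain ⟨l, hl⟩ := Option.ne_none_iff_exists'.1 hxO
  set u : PartialAssignment n k := Function.update o x none with hu
  have hus : u.supp = o.supp \ {x} := by
    ext a
    by_cases ha : a = x <;> simp [supp, hu, ha]
  have huo : u.assign (x, l) = o := by
    simp [hu, assign, ← hl]
  have hsu : Restricts s u := by
    intro a
    by_cases ha : a = x
    · left; subst ha; simpa [supp] using hxS
    · simpa [hu, Function.update_of_ne ha] using hso a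
  obtain ⟨j, hij⟩ := exists_type_ne hk i
  refine ⟨u.assign (e, i), by rwa [supp_assign, hus], hsu.assign _, ?_⟩
  have heu : e ∉ u.supp := by rwa [hus]
  -- `h1` and `h4` bound the loss from removing `x`; `h2`, `h3` and `h5` bound the loss from
  -- inserting `(e, i)`. Each is at most the greedy gain plus `η`.
  have h1 := hf.gain_le_gain hsu (p := (x, l)) (by simp [hus])
  have h2 := hf.gain_le_gain hsu (p := (e, j)) heu
  have h3 := hf.pairwise_monotone heu hij
  have h4 := hmax (x, l) (mem_candidates.2 ⟨hxS,
    ho.indep.subset (Set.insert_subset hxO hso.supp_subset)⟩)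
  have h5 := hmax (e, j) (mem_candidates.2 ⟨hes, hei⟩)
  rw [huo] at h1
  linarith

/-- The potential `f o + 2 * f s` loses at most `2 * η = 4 * ε` per iteration: comparing two oracle
answers costs `η = 2 * ε`. Each iteration also shrinks `o.supp \ s.supp` by one, so the budget `r`
suffices to reach `s = o`. -/
theorem guarantees_run {f : PartialAssignment n k → ℝ} (hf : IsKSubmodular f) (hk : 2 ≤ k)
    {ε : ℝ} (hε : 0 ≤ ε) :
    ∀ (r : ℕ) (s o : PartialAssignment n k), 𝓜.IsBase o.supp → Restricts s o →
      (o.supp \ s.supp).ncard ≤ r →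
      (run 𝓜 c r s).Guarantees f ε (fun S => f o + 2 * f s ≤ 3 * f S + 4 * r * ε) (n * k * r)
  | 0, s, o, _, hso, hr => by
    have : s = o := hso.eq_of_supp_subset (by
      rwa [Nat.le_zero, Set.ncard_eq_zero, Set.sdiff_eq_empty] at hr)
    subst this
    simp only [run, OracleAlgorithm.Guarantees, Nat.cast_zero]
    linarith
  | r + 1, s, o, ho, hso, hr => by
    have hQ : (candidates 𝓜 c s).length + n * k * r ≤ n * k * (r + 1) := by
      have := length_candidates_le (𝓜 := 𝓜) (c := c) s
      rw [Nat.mul_succ]; omega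
    refine OracleAlgorithm.Guarantees.mono (fun _ h => h)
      (OracleAlgorithm.guarantees_queryEach _ _ _ _ _ (nodup_candidates s) fun w hw _ => ?_) hQ
    split_ifs with hS
    · set p := c.pick s _ hS with hp
      obtain ⟨hpL, hmax⟩ := mem_maximizers.1 (c.pick_mem s _ hS)
      rw [← hp] at hpL hmax
      obtain ⟨o', ho', hso', hle⟩ := exists_exchange hf hk ho hso hpL (η := 2 * ε) fun q hq => by
        have h1 := abs_le.1 (hw q hq)
        have h2 := abs_le.1 (hw p hpL)
        linarith [hmax q hq]
      have hcard : (o'.supp \ (s.assign p).supp).ncard ≤ r := by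
        have h1 := Set.ncard_sdiff_add_ncard_of_subset hso.supp_subset
        have h2 := Set.ncard_sdiff_add_ncard_of_subset hso'.supp_subset
        have h3 : (s.assign p).supp.ncard = s.supp.ncard + 1 := by
          rw [supp_assign, Set.ncard_insert_of_notMem (mem_candidates.1 hpL).1]
        have h4 := ho.ncard_eq_ncard_of_isBase ho'
        omega
      refine (guarantees_run hf hk hε r _ o' ho' hso' hcard).mono (fun S hS => ?_) le_rfl
      push_cast
      linarith
    -- Stopping early is harmless: any element of `o` outside `s` would be a candidate, so `s = o`
    -- already.
    · have hnil : candidates 𝓜 c s = [] := by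
        by_contra h
        exact hS (maximizers_nonempty h w)
      have : s = o := hso.eq_of_supp_subset fun x hx => by
        by_contra hxs
        have : (x, (⟨0, by omega⟩ : Fin k)) ∈ candidates 𝓜 c s := mem_candidates.2 ⟨hxs,
          ho.indep.subset (Set.insert_subset hx hso.supp_subset)⟩
        simp [hnil] at this
      subst this
      have : 0 ≤ 4 * ((r + 1 : ℕ) : ℝ) * ε := by positivity
      simp only [OracleAlgorithm.Guarantees]
      linarith

/-- With an `ε`-accurate oracle for `f ≥ 0`, the greedy algorithm is a `1/3`-approximation up to
an error of `4/3 * M * ε`, after at most `n * k * M` queries. -/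
theorem guarantees_algorithm {f : PartialAssignment n k → ℝ} (hf : IsKSubmodular f)
    (hf0 : ∀ x, 0 ≤ f x) (hk : 2 ≤ k) {M : ℕ} (hM : 𝓜.eRank = M) {ε : ℝ} (hε : 0 ≤ ε) :
    (algorithm 𝓜 c M).Guarantees f ε
      (fun S => 1 / 3 * sSup (f '' {x | Feasible 𝓜 x}) - 4 / 3 * M * ε ≤ f S) (n * k * M) := by
  have hne : (f '' {x | Feasible 𝓜 x}).Nonempty :=
    ⟨_, fun _ => none, by simp [Feasible, supp], rfl⟩
  obtain ⟨x, hx, hfx⟩ := hne.csSup_mem (Set.toFinite _)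
  obtain ⟨o, ho, hxo⟩ := hf.exists_isBase_supp hk hx
  refine (guarantees_run hf hk hε M (fun _ => none) o ho (fun _ => Or.inl rfl) ?_).mono ?_ le_rfl
  · have h1 : o.supp.ncard = M := by
      have := ho.encard_eq_eRank
      rw [hM] at this
      simp [Set.ncard, this]
    exact (Set.ncard_le_ncard Set.sdiff_subset).trans h1.le
  · intro S hS
    have := hf0 fun _ => none
    rw [← hfx]
    linarith

end MatroidGreedy

/-! ### Dynamics of explore-then-commit -/

namespace BanditPolicy

variable {A : Type}

theorem history_congr (π : BanditPolicy A) {F G : ℕ → A → ℝ} :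
    ∀ {t : ℕ}, (∀ j < t, F j = G j) → history π F t = history π G t
  | 0, _ => rfl
  | t + 1, h => by
    rw [history, history, history_congr π fun j hj => h j (by omega), h t (by omega)]

theorem action_congr (π : BanditPolicy A) {F G : ℕ → A → ℝ} {t : ℕ}
    (h : ∀ j < t, F j = G j) : action π F t = action π G t :=
  congrArg π (history_congr π h)

/-- The mean of the rewards of action `a` in the `m` rounds starting with round `t`. -/
noncomputable def blockMean (m : ℕ) (F : ℕ → A → ℝ) (t : ℕ) (a : A) : ℝ :=
  (∑ j ∈ Finset.range m, F (t + j) a) / m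

end BanditPolicy

namespace CETC

open BanditPolicy OracleAlgorithm

variable {A : Type} {m : ℕ}

theorem action_output (S : A) (F : ℕ → A → ℝ) (t : ℕ) :
    action (policy m (.output S)) F t = S := by
  simp [action, policy]

theorem history_query (a : A) (next : ℝ → OracleAlgorithm A) (F : ℕ → A → ℝ) :
    ∀ {t : ℕ}, t ≤ m →
      history (policy m (.query a next)) F t = (List.range t).map fun j => F j a
  | 0, _ => rfl
  | t + 1, ht => by
    rw [history, history_query a next F (Nat.le_of_succ_le ht), List.range_succ]
    have : t < m := ht
    simp [policy, this]

theorem action_query_of_lt (a : A) (next : ℝ → OracleAlgorithm A) (F : ℕ → A → ℝ) {t : ℕ}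
    (ht : t < m) : action (policy m (.query a next)) F t = a := by
  rw [action, history_query a next F ht.le]
  simp [policy, ht]

theorem policy_query_append (a : A) (next : ℝ → OracleAlgorithm A) (F : ℕ → A → ℝ)
    (l : List ℝ) :
    policy m (.query a next) (((List.range m).map fun j => F j a) ++ l) =
      policy m (next (blockMean m F 0 a)) l := by
  have hsum : ((List.range m).map fun j => F j a).sum = ∑ j ∈ Finset.range m, F j a := by
    rw [Finset.sum_range]; simp [← List.sum_ofFn, List.ofFn_eq_map, ← List.map_coe_finRange_eq_range]
    rfl
  have hlen : ((List.range m).map fun j => F j a).length = m := by simp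
  rw [policy, if_neg (by simp), List.take_left' hlen, List.drop_left' hlen, hsum]
  simp [blockMean]

/-- After one block the policy is again explore-then-commit, for the continued algorithm and the
shifted rewards. This self-similarity drives the inductions below. -/
theorem history_query_add (a : A) (next : ℝ → OracleAlgorithm A) (F : ℕ → A → ℝ) :
    ∀ t : ℕ, history (policy m (.query a next)) F (m + t) =
      ((List.range m).map fun j => F j a) ++
        history (policy m (next (blockMean m F 0 a))) (fun j => F (m + j)) t
  | 0 => by simp [history_query, history]
  | t + 1 => by
    rw [← add_assoc, history, history_query_add a next F t, policy_query_append, history,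
      List.append_assoc]

theorem action_query_add (a : A) (next : ℝ → OracleAlgorithm A) (F : ℕ → A → ℝ) (t : ℕ) :
    action (policy m (.query a next)) F (m + t) =
      action (policy m (next (blockMean m F 0 a))) (fun j => F (m + j)) t := by
  rw [action, history_query_add, policy_query_append]
  rfl

/-- If the empirical means of the first `Q` blocks are `ε`-accurate, then after these blocks
explore-then-commit plays an action that is guaranteed by the offline algorithm. -/
theorem action_of_guarantees {f : A → ℝ} {ε : ℝ} {P : A → Prop} :
    ∀ {alg : OracleAlgorithm A} {Q : ℕ} {F : ℕ → A → ℝ}, (0 < Q → 0 < m) →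
      alg.Guarantees f ε P Q →
      (∀ q < Q, |blockMean m F (q * m) (action (policy m alg) F (q * m)) -
        f (action (policy m alg) F (q * m))| ≤ ε) →
      ∀ {t : ℕ}, Q * m ≤ t → P (action (policy m alg) F t)
  | .output S, _, F, _, h, _, t, _ => by rwa [action_output]
  | .query _ _, 0, _, _, h, _, _, _ => h.elim
  | .query a next, Q + 1, F, hm, h, hF, t, ht => by
    -- Positivity of `m` ensures that round `0` really plays the queried action `a`.
    have hm := hm Q.succ_pos
    have h0 := hF 0 Q.succ_pos
    rw [zero_mul, action_query_of_lt a next F hm] at h0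
    obtain ⟨t, rfl⟩ : ∃ t', t = m + t' := Nat.exists_eq_add_of_le (by nlinarith)
    rw [action_query_add]
    refine action_of_guarantees (fun _ => hm) (h _ h0) (fun q hq => ?_) (by nlinarith)
    have := hF (q + 1) (by omega)
    rw [show (q + 1) * m = m + q * m by ring, action_query_add] at this
    simpa [blockMean, add_assoc] using this

/-! ### Measurability of explore-then-commit -/

variable [MeasurableSpace A]

/-- The actions that explore-then-commit plays around the algorithms `alg x` depend measurably on
`x` and on the rewards. -/
def MeasurableFamily (m : ℕ) {X : Type*} [MeasurableSpace X] (alg : X → OracleAlgorithm A) :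
    Prop :=
  ∀ t, Measurable fun p : X × (ℕ → A → ℝ) => action (policy m (alg p.1)) p.2 t

variable {X Y : Type*} [MeasurableSpace X] [MeasurableSpace Y]

theorem measurableFamily_output (S : A) :
    MeasurableFamily m fun _ : X => OracleAlgorithm.output S := by
  intro t
  simp only [action_output]
  exact measurable_const

theorem MeasurableFamily.comp {alg : X → OracleAlgorithm A} (h : MeasurableFamily m alg)
    {g : Y → X} (hg : Measurable g) : MeasurableFamily m fun y => alg (g y) :=
  fun t => (h t).comp ((hg.comp measurable_fst).prodMk measurable_snd)

/-- During the block the action is constant. Afterwards the oracle answer, a measurable function of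
the rewards, joins the parameter; hence the need for families. -/
theorem MeasurableFamily.query (a : A) {next : X → ℝ → OracleAlgorithm A}
    (h : MeasurableFamily m fun p : X × ℝ => next p.1 p.2) :
    MeasurableFamily m fun x => .query a (next x) := by
  intro t
  rcases lt_or_ge t m with ht | ht
  · simp only [action_query_of_lt _ _ _ ht]
    exact measurable_const
  · obtain ⟨t, rfl⟩ := Nat.exists_eq_add_of_le ht
    simp only [action_query_add]
    refine (h t).comp (g := fun q : (X × ℝ) × (ℕ → A → ℝ) => action (policy m (next q.1.1 q.1.2)) q.2 t)
      (f := fun p : X × (ℕ → A → ℝ) => ((p.1, blockMean m p.2 0 a), fun j => p.2 (m + j))) ?_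
    unfold blockMean
    fun_prop

theorem measurableFamily_of_countable [Countable X] [MeasurableSingletonClass X]
    {alg : X → OracleAlgorithm A} (h : ∀ x, MeasurableFamily m fun _ : Unit => alg x) :
    MeasurableFamily m alg :=
  fun t => measurable_from_prod_countable_right fun x =>
    (h x t).comp (measurable_const (a := ()) |>.prodMk measurable_id)

theorem MeasurableFamily.queryEach {ι : Type} [DecidableEq ι] (act : ι → A)
    {next : (ι → ℝ) → OracleAlgorithm A} (h : MeasurableFamily m next) :
    ∀ L : List ι, MeasurableFamily m (OracleAlgorithm.queryEach act L next)
  | [] => h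
  | p :: L => by
    refine MeasurableFamily.query (act p) (next := fun v y =>
      OracleAlgorithm.queryEach act L next (Function.update v p y)) ?_
    refine (MeasurableFamily.queryEach act h L).comp
      (g := fun q : (ι → ℝ) × ℝ => Function.update q.1 p q.2) ?_
    exact measurable_update'

end CETC

namespace MatroidGreedy

open CETC

variable {n k : ℕ} {𝓜 : Matroid (Fin n)} {c : GreedyChoices n k} {m : ℕ}

theorem measurableSet_maximizers_eq (L : List (Fin n × Fin k)) (S : Finset (Fin n × Fin k)) :
    MeasurableSet {v : Fin n × Fin k → ℝ | maximizers L v = S} := by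
  simp only [Finset.ext_iff, mem_maximizers]
  measurability

/-- The continuation depends on the answer table only through the set of maximizers, which has
finitely many values and measurable level sets. An arbitrary tie-breaking rule is therefore
harmless. -/
theorem measurableFamily_run [MeasurableSpace (PartialAssignment n k)] :
    ∀ (r : ℕ) (s : PartialAssignment n k),
      MeasurableFamily m fun _ : Unit => run 𝓜 c r s
  | 0, s => measurableFamily_output s
  | r + 1, s => by
    let _ : MeasurableSpace (Finset (Fin n × Fin k)) := ⊤
    refine (MeasurableFamily.queryEach s.assign (next := fun v =>
        if hS : (maximizers (candidates 𝓜 c s) v).Nonempty then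
          run 𝓜 c r (s.assign (c.pick s (maximizers (candidates 𝓜 c s) v) hS))
        else .output s) ?_ (candidates 𝓜 c s)).comp (measurable_const (a := 0))
    refine MeasurableFamily.comp (g := maximizers (candidates 𝓜 c s))
      (alg := fun S : Finset (Fin n × Fin k) => if hS : S.Nonempty then
        run 𝓜 c r (s.assign (c.pick s S hS)) else .output s)
      (measurableFamily_of_countable fun S => ?_) (measurable_to_countable' fun S => ?_)
    · by_cases hS : S.Nonempty
      · simp only [hS, dite_true]
        exact measurableFamily_run r _
      · simp only [hS, dite_false]
        exact measurableFamily_output s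
    · exact measurableSet_maximizers_eq _ S

theorem measurable_action_algorithm [MeasurableSpace (PartialAssignment n k)] (M t : ℕ) :
    Measurable fun F : ℕ → PartialAssignment n k → ℝ =>
      BanditPolicy.action (policy m (algorithm 𝓜 c M)) F t :=
  (measurableFamily_run (m := m) M _ t).comp (measurable_const (a := ()) |>.prodMk measurable_id)

end MatroidGreedy

/-! ### Rewards of adaptively chosen actions -/

/-- Conditioning on a finite-valued `X` done by hand: expand over the events `X = a` and factor each
product by independence. -/
theorem ProbabilityTheory.IndepFun.integral_comp_eq_sum {Ω A E : Type*} [MeasurableSpace Ω]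
    {μ : Measure Ω} [IsProbabilityMeasure μ] [Fintype A] [MeasurableSpace A]
    [DiscreteMeasurableSpace A] [MeasurableSpace E] {X : Ω → A} {Y : Ω → E}
    (hXY : IndepFun X Y μ) (hX : Measurable X) {g : A → E → ℝ}
    (hg : ∀ a, Measurable (g a)) (hint : ∀ a, Integrable (fun ω => g a (Y ω)) μ) :
    ∫ ω, g (X ω) (Y ω) ∂μ = ∑ a, μ.real (X ⁻¹' {a}) * ∫ ω, g a (Y ω) ∂μ := by
  classical
  let χ : A → A → ℝ := fun a b => if b = a then 1 else 0
  have hχ : ∀ a, Measurable (χ a) := fun a => .of_discrete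
  have h1 : ∀ ω, g (X ω) (Y ω) = ∑ a, χ a (X ω) * g a (Y ω) := fun ω => by simp [χ]
  have h2 : ∀ a, Integrable (fun ω => χ a (X ω) * g a (Y ω)) μ := fun a => by
    refine (hint a).bdd_mul (c := 1) ((hχ a).comp hX).aestronglyMeasurable (.of_forall fun ω => ?_)
    by_cases h : X ω = a <;> simp [χ, h]
  simp_rw [h1]
  rw [integral_finsetSum _ fun a _ => h2 a]
  refine Finset.sum_congr rfl fun a _ => ?_
  refine ((hXY.comp (hχ a) (hg a)).integral_fun_mul_eq_mul_integral
    ((hχ a).comp hX).aestronglyMeasurable (hint a).aestronglyMeasurable).trans ?_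
  refine congrArg (· * ∫ ω, g a (Y ω) ∂μ) ?_
  have : (χ a ∘ X) = (X ⁻¹' {a}).indicator 1 := by
    funext ω; by_cases h : X ω = a <;> simp [χ, h]
  rw [this, integral_indicator_one (hX (measurableSet_singleton a))]

theorem ProbabilityTheory.IndepFun.measureReal_mem_le {Ω A E : Type*} [MeasurableSpace Ω]
    {μ : Measure Ω} [IsProbabilityMeasure μ] [Fintype A] [MeasurableSpace A]
    [DiscreteMeasurableSpace A] [MeasurableSpace E] {X : Ω → A} {Y : Ω → E}
    (hXY : IndepFun X Y μ) (hX : Measurable X) (hY : Measurable Y) {s : A → Set E}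
    (hs : ∀ a, MeasurableSet (s a)) {B : ℝ} (hB : ∀ a, μ.real {ω | Y ω ∈ s a} ≤ B) :
    μ.real {ω | Y ω ∈ s (X ω)} ≤ B := by
  let g : A → E → ℝ := fun a => (s a).indicator 1
  have hg : ∀ a, Measurable (g a) := fun a => measurable_one.indicator (hs a)
  have hgY : ∀ a, (fun ω => g a (Y ω)) = (Y ⁻¹' s a).indicator 1 := fun a => by
    funext ω; by_cases h : Y ω ∈ s a <;> simp [g, h]
  have hm : MeasurableSet {ω | Y ω ∈ s (X ω)} := by
    have : {ω | Y ω ∈ s (X ω)} = ⋃ a, X ⁻¹' {a} ∩ Y ⁻¹' s a := by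
      ext ω; simp
    rw [this]
    exact .iUnion fun a => (hX (measurableSet_singleton a)).inter (hY (hs a))
  have key := hXY.integral_comp_eq_sum hX hg fun a => by
    rw [hgY]; exact (integrable_const (1 : ℝ)).indicator (hY (hs a))
  have hl : (fun ω => g (X ω) (Y ω)) = {ω | Y ω ∈ s (X ω)}.indicator 1 := by
    funext ω; by_cases h : Y ω ∈ s (X ω) <;> simp [g, h]
  rw [hl, integral_indicator_one hm] at key
  rw [key]
  calc _ ≤ ∑ a, μ.real (X ⁻¹' {a}) * B := by
        gcongr with a
        rw [hgY, integral_indicator_one (hY (hs a))]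
        exact hB a
    _ = B := by
        rw [← Finset.sum_mul, sum_measureReal_preimage_singleton _
          (fun a _ => hX (measurableSet_singleton a))]
        simp

namespace IsStochasticReward

open BanditPolicy

variable {Ω A : Type*} [MeasurableSpace Ω] {μ : Measure Ω}
  {F : ℕ → Ω → A → ℝ} {f : A → ℝ}

theorem measurable_apply (h : IsStochasticReward μ F f) (t : ℕ) (a : A) :
    Measurable fun ω => F t ω a := (measurable_pi_apply a).comp (h.measurable t)

theorem integral_eq (h : IsStochasticReward μ F f) (t : ℕ) (a : A) :
    ∫ ω, F t ω a ∂μ = f a := by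
  rw [h.expectation]
  exact ((h.identDistrib t).comp (measurable_pi_apply a)).integral_eq

theorem measurable_action {A : Type} [MeasurableSpace A] {F : ℕ → Ω → A → ℝ} {f : A → ℝ}
    {π : BanditPolicy A} (h : IsStochasticReward μ F f)
    (hπ : ∀ t, Measurable fun G : ℕ → A → ℝ => action π G t) (t : ℕ) :
    Measurable fun ω => action π (fun j => F j ω) t :=
  (hπ t).comp (measurable_pi_lambda _ fun j => h.measurable j)

/-- The action in round `t` is a function of the rewards before `t`, a set of rounds disjoint from
the window. The map `e` pads those rewards by zero, which the action cannot see. -/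
theorem indepFun_action {A : Type} [MeasurableSpace A] {F : ℕ → Ω → A → ℝ} {f : A → ℝ}
    {π : BanditPolicy A} (h : IsStochasticReward μ F f)
    (hπ : ∀ t, Measurable fun G : ℕ → A → ℝ => action π G t) (t m : ℕ) :
    IndepFun (fun ω => action π (fun j => F j ω) t)
      (fun ω (i : Finset.Ico t (t + m)) => F i ω) μ := by
  have hd : Disjoint (Finset.range t) (Finset.Ico t (t + m)) := by
    rw [Finset.disjoint_left]; intro i hi hi'
    simp only [Finset.mem_range, Finset.mem_Ico] at hi hi'; omega
  let e : (Finset.range t → A → ℝ) → ℕ → A → ℝ := fun g j =>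
    if hj : j ∈ Finset.range t then g ⟨j, hj⟩ else 0
  have he : Measurable e := measurable_pi_lambda _ fun j => by
    by_cases hj : j ∈ Finset.range t
    · simp only [e, hj, dite_true]; exact measurable_pi_apply _
    · simp only [e, hj, dite_false]; exact measurable_const
  have := (h.indep.indepFun_finset _ _ hd h.measurable).comp ((hπ t).comp he) measurable_id
  refine IndepFun.congr this (.of_forall fun ω => ?_) .rfl
  refine action_congr π fun j hj => ?_
  simp [e, hj]

variable [IsProbabilityMeasure μ]

theorem integrable (h : IsStochasticReward μ F f) (t : ℕ) (a : A) :
    Integrable (fun ω => F t ω a) μ :=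
  Integrable.of_mem_Icc 0 1 (h.measurable_apply t a).aemeasurable
    (.of_forall fun ω => h.mem_Icc t ω a)

theorem mean_mem_Icc (h : IsStochasticReward μ F f) (a : A) : f a ∈ Set.Icc (0 : ℝ) 1 := by
  rw [h.expectation a]
  refine ⟨integral_nonneg fun ω => (h.mem_Icc 0 ω a).1, ?_⟩
  have := integral_mono (h.integrable 0 a) (integrable_const (1 : ℝ)) fun ω => (h.mem_Icc 0 ω a).2
  simpa using this

/-- Hoeffding's inequality for the mean reward of a fixed action. -/
theorem measure_blockMean_le {A : Type} {F : ℕ → Ω → A → ℝ} {f : A → ℝ}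
    (h : IsStochasticReward μ F f) (m t : ℕ) (a : A) {ε : ℝ} (hε : 0 ≤ ε) :
    μ.real {ω | ε < |blockMean m (fun j => F j ω) t a - f a|} ≤
      2 * Real.exp (-2 * m * ε ^ 2) := by
  rcases Nat.eq_zero_or_pos m with rfl | hm
  · have : μ.real {ω | ε < |blockMean 0 (fun j => F j ω) t a - f a|} ≤ 1 := measureReal_le_one
    simp only [Nat.cast_zero, mul_zero, zero_mul, Real.exp_zero]
    linarith
  have hm' : (0 : ℝ) < m := by exact_mod_cast hm
  have hind : iIndepFun (fun j ω => F (t + j) ω a - f a) μ :=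
    (h.indep.precomp (add_right_injective t)).comp (fun _ x => x a - f a)
      fun _ => (measurable_pi_apply a).sub_const _
  have hsub : ∀ j < m, HasSubgaussianMGF (fun ω => F (t + j) ω a - f a)
      ((‖(1 : ℝ) - 0‖₊ / 2) ^ 2) μ := fun j _ => by
    have := hasSubgaussianMGF_of_mem_Icc (μ := μ) (h.measurable_apply (t + j) a).aemeasurable
      (.of_forall fun ω => h.mem_Icc (t + j) ω a)
    rwa [h.integral_eq] at this
  -- A variable in an interval of length `1` has sub-Gaussian parameter `1/4`, whence the exponent.
  have hexp : -(m * ε) ^ 2 / (2 * m * (((‖(1 : ℝ) - 0‖₊ / 2) ^ 2 : NNReal) : ℝ)) =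
      -2 * m * ε ^ 2 := by
    simp; field_simp
  have h1 := HasSubgaussianMGF.measure_sum_range_ge_le_of_iIndepFun hind hsub
    (ε := m * ε) (by positivity)
  have h2 := HasSubgaussianMGF.measure_sum_range_ge_le_of_iIndepFun
    (X := fun j ω => -(F (t + j) ω a - f a))
    (hind.comp (fun _ x => -x) fun _ => measurable_neg) (fun j hj => (hsub j hj).neg)
    (ε := m * ε) (by positivity)
  rw [hexp] at h1 h2
  rw [two_mul]
  refine le_trans ?_ ((measureReal_union_le _ _).trans (add_le_add h1 h2))
  refine measureReal_mono ?_
  intro ω hω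
  have hω : ε < |blockMean m (fun j => F j ω) t a - f a| := hω
  have hs : m * (blockMean m (fun j => F j ω) t a - f a) =
      ∑ j ∈ Finset.range m, (F (t + j) ω a - f a) := by
    simp [blockMean, mul_sub]; field_simp
  rcases lt_abs.1 hω with h' | h'
  · left
    change m * ε ≤ ∑ j ∈ Finset.range m, (F (t + j) ω a - f a)
    rw [← hs]; gcongr
  · right
    change m * ε ≤ ∑ j ∈ Finset.range m, -(F (t + j) ω a - f a)
    rw [Finset.sum_neg_distrib, ← hs, ← mul_neg]; gcongr

section Adaptive

variable {A : Type} [MeasurableSpace A] {F : ℕ → Ω → A → ℝ} {f : A → ℝ} {π : BanditPolicy A}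
  [Fintype A] [DiscreteMeasurableSpace A]

theorem integral_reward_action (h : IsStochasticReward μ F f)
    (hπ : ∀ t, Measurable fun G : ℕ → A → ℝ => action π G t) (t : ℕ) :
    ∫ ω, F t ω (action π (fun j => F j ω) t) ∂μ =
      ∫ ω, f (action π (fun j => F j ω) t) ∂μ := by
  have hind := h.indepFun_action hπ t 1
  have hX := h.measurable_action hπ t
  have hY : Measurable fun ω (i : Finset.Ico t (t + 1)) => F i ω :=
    measurable_pi_lambda _ fun i => h.measurable i
  have h1 := hind.integral_comp_eq_sum hX (g := fun a y => y ⟨t, by simp⟩ a)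
    (fun a => (measurable_pi_apply a).comp (measurable_pi_apply _)) (fun a => h.integrable t a)
  have h2 := hind.integral_comp_eq_sum hX (g := fun a _ => f a)
    (fun a => measurable_const) (fun a => integrable_const _)
  rw [h1, h2]
  simp [h.integral_eq]

theorem measure_blockMean_action_le (h : IsStochasticReward μ F f)
    (hπ : ∀ t, Measurable fun G : ℕ → A → ℝ => action π G t) (m t : ℕ) {ε : ℝ} (hε : 0 ≤ ε) :
    μ.real {ω | ε < |blockMean m (fun j => F j ω) t (action π (fun j => F j ω) t) -
        f (action π (fun j => F j ω) t)|} ≤ 2 * Real.exp (-2 * m * ε ^ 2) := by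
  have hX := h.measurable_action hπ t
  have hY : Measurable fun ω (i : Finset.Ico t (t + m)) => F i ω :=
    measurable_pi_lambda _ fun i => h.measurable i
  have hs : ∀ a, MeasurableSet
      {y : Finset.Ico t (t + m) → A → ℝ | ε < |(∑ i, y i a) / m - f a|} := fun a =>
    measurableSet_lt measurable_const (by fun_prop)
  have hsum : ∀ ω a, (∑ i : Finset.Ico t (t + m), F i ω a) / m =
      blockMean m (fun j => F j ω) t a := fun ω a => by
    rw [Finset.sum_coe_sort (Finset.Ico t (t + m)) (fun i => F i ω a), Finset.sum_Ico_eq_sum_range,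
      Nat.add_sub_cancel_left, blockMean]
  have key := (h.indepFun_action hπ t m).measureReal_mem_le hX hY hs
    (B := 2 * Real.exp (-2 * m * ε ^ 2)) fun a => by
      simp only [Set.mem_ofPred_eq, hsum]
      exact h.measure_blockMean_le m t a hε
  simpa only [Set.mem_ofPred_eq, hsum] using key

/-- The regret of explore-then-commit around an offline algorithm that outputs an
`η`-approximation of `α * max f` with at most `Q` queries to an `ε`-accurate oracle. -/
theorem expectedRegret_le (h : IsStochasticReward μ F f) {alg : OracleAlgorithm A} {m Q T : ℕ}
    {α ε η : ℝ} {D : Set A} (hε : 0 ≤ ε) (hη : 0 ≤ η) (hQ : 0 < Q → 0 < m)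
    (hv : α * sSup (f '' D) ≤ 1)
    (hπ : ∀ t, Measurable fun G : ℕ → A → ℝ => action (CETC.policy m alg) G t)
    (halg : alg.Guarantees f ε (fun S => α * sSup (f '' D) - η ≤ f S) Q) :
    expectedRegret μ α D f F T (CETC.policy m alg) ≤
      Q * m + T * (η + Q * (2 * Real.exp (-2 * m * ε ^ 2))) := by
  set v := α * sSup (f '' D) with hvdef
  set π := CETC.policy m alg
  set p := 2 * Real.exp (-2 * m * ε ^ 2)
  have hmeasA := h.measurable_action hπ
  -- Blocks start at the fixed rounds `q * m` and all `Q` are included, even those after commitment,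
  -- so the random number of queries never enters the union bound.
  let bad : ℕ → Set Ω := fun q => {ω | ε < |blockMean m (fun j => F j ω) (q * m)
    (action π (fun j => F j ω) (q * m)) - f (action π (fun j => F j ω) (q * m))|}
  -- The measurable hull has the same measure and an integrable indicator.
  let B : Set Ω := toMeasurable μ (⋃ q ∈ Finset.range Q, bad q)
  have hB : μ.real B ≤ Q * p := by
    rw [measureReal_def, measure_toMeasurable, ← measureReal_def]
    refine (measureReal_biUnion_finset_le _ _).trans ?_
    calc _ ≤ ∑ _q ∈ Finset.range Q, p :=
          Finset.sum_le_sum fun q _ => h.measure_blockMean_action_le hπ m (q * m) hε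
      _ = _ := by simp
  have hfA : ∀ t, Integrable (fun ω => f (action π (fun j => F j ω) t)) μ := fun t =>
    Integrable.of_mem_Icc 0 1 ((Measurable.of_discrete (f := f)).comp (hmeasA t)).aemeasurable
      (.of_forall fun ω => h.mean_mem_Icc _)
  have hFA : ∀ t, Integrable (fun ω => F t ω (action π (fun j => F j ω) t)) μ := fun t => by
    refine Integrable.of_mem_Icc 0 1 (Measurable.aemeasurable ?_)
      (.of_forall fun ω => h.mem_Icc t ω _)
    exact (measurable_from_prod_countable_right (f := fun p : A × (A → ℝ) => p.2 p.1)
      fun a => measurable_pi_apply a).comp ((hmeasA t).prodMk (h.measurable t))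
  have hp : 0 ≤ Q * p := by positivity
  -- A round in the first `Q * m` costs at most `v ≤ 1`. A later one costs at most `η` off `B` and
  -- at most `1` more on `B`.
  have hround : ∀ t, v - ∫ ω, f (action π (fun j => F j ω) t) ∂μ ≤
      (if t < Q * m then 1 else 0) + (η + Q * p) := by
    intro t
    split_ifs with ht
    · have : 0 ≤ ∫ ω, f (action π (fun j => F j ω) t) ∂μ :=
        integral_nonneg fun ω => (h.mean_mem_Icc _).1
      linarith
    · have hle : ∀ ω, (v - η) - B.indicator 1 ω ≤ f (action π (fun j => F j ω) t) := by
        intro ω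
        by_cases hω : ω ∈ B
        · have := (h.mean_mem_Icc (action π (fun j => F j ω) t)).1
          simp only [Set.indicator_of_mem hω, Pi.one_apply]
          linarith
        · have hω' : ∀ q < Q, ω ∉ bad q := fun q hq hb => hω (subset_toMeasurable _ _
            (Set.mem_biUnion (Finset.mem_coe.2 (Finset.mem_range.2 hq)) hb))
          simp only [Set.indicator_of_notMem hω, sub_zero]
          exact CETC.action_of_guarantees hQ halg (fun q hq => not_lt.1 (hω' q hq)) (not_lt.1 ht)
      have hBi : Integrable (B.indicator (1 : Ω → ℝ)) μ :=
        (integrable_const (1 : ℝ)).indicator (measurableSet_toMeasurable _ _)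
      have := integral_mono ((integrable_const (v - η)).sub hBi) (hfA t) hle
      rw [integral_sub' (integrable_const _) hBi,
        integral_indicator_one (measurableSet_toMeasurable _ _)] at this
      simp only [integral_const, probReal_univ, smul_eq_mul, one_mul] at this
      linarith
  have hreg : expectedRegret μ α D f F T π =
      ∑ t ∈ Finset.range T, (v - ∫ ω, f (action π (fun j => F j ω) t) ∂μ) := by
    rw [expectedRegret, integral_finsetSum _ fun t _ => hFA t, Finset.sum_sub_distrib,
      Finset.sum_congr rfl fun t _ => h.integral_reward_action hπ t]
    simp only [Finset.sum_const, Finset.card_range, nsmul_eq_mul, hvdef]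
    ring
  have hcount : ∑ t ∈ Finset.range T, (if t < Q * m then (1 : ℝ) else 0) ≤ Q * m := by
    rw [Finset.sum_boole, ← Nat.cast_mul, Nat.cast_le]
    refine (Finset.card_le_card (t := Finset.range (Q * m)) fun t ht => ?_).trans_eq
      (Finset.card_range _)
    exact Finset.mem_range.2 (Finset.mem_filter.1 ht).2
  rw [hreg]
  refine (Finset.sum_le_sum fun t _ => hround t).trans ?_
  rw [Finset.sum_add_distrib, Finset.sum_const, Finset.card_range, nsmul_eq_mul]
  linarith

end Adaptive

end IsStochasticReward

/-! ### The regret bound -/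

theorem Real.rpow_two_thirds {x : ℝ} (hx : 0 ≤ x) :
    x ^ (2 / 3 : ℝ) = (x ^ (1 / 3 : ℝ)) ^ 2 := by
  rw [← Real.rpow_natCast, ← Real.rpow_mul hx]; norm_num

theorem Real.rpow_third_pow_three {x : ℝ} (hx : 0 ≤ x) : (x ^ (1 / 3 : ℝ)) ^ 3 = x := by
  rw [← Real.rpow_natCast, ← Real.rpow_mul hx]; norm_num

/-- In terms of cube roots every quantity is rational. With `R` the target rate, exploration costs
`9/8 * R`, rounding `m` up `2 * R`, oracle error `8/3 * R` and failure `4 * R`; the total is below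
`10 * R`. -/
theorem CETC.regret_arith {K M T : ℝ} (hK : 1 ≤ K) (hM : 1 ≤ M) (hKT : K ≤ T) (hT : 2 ≤ T)
    {m : ℕ} (hm : m = CETC.explorationLength (4 / 3 * (M + 1)) (K * M) T) :
    0 < m ∧ K * M * m + T * (4 / 3 * M * √(Real.log T / m) +
        K * M * (2 * Real.exp (-2 * m * √(Real.log T / m) ^ 2))) ≤
      10 * (K ^ (1 / 3 : ℝ) * M * T ^ (2 / 3 : ℝ) * Real.log T ^ (1 / 3 : ℝ)) := by
  have hL : 1 / 2 ≤ Real.log T := by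
    have := Real.log_two_gt_d9
    linarith [Real.log_le_log two_pos hT]
  have hexpL : Real.exp (Real.log T) = T := Real.exp_log (by linarith)
  set L := Real.log T
  have hT0 : 0 ≤ T := by linarith
  have hδ0 : 0 ≤ 4 / 3 * (M + 1) := by linarith
  obtain ⟨a, ha⟩ : ∃ a, a = K ^ (1 / 3 : ℝ) := ⟨_, rfl⟩
  obtain ⟨u, hu⟩ : ∃ u, u = M ^ (1 / 3 : ℝ) := ⟨_, rfl⟩
  obtain ⟨t, ht⟩ : ∃ t, t = T ^ (1 / 3 : ℝ) := ⟨_, rfl⟩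
  obtain ⟨l, hl⟩ : ∃ l, l = L ^ (1 / 3 : ℝ) := ⟨_, rfl⟩
  obtain ⟨d, hd⟩ : ∃ d, d = (4 / 3 * (M + 1)) ^ (1 / 3 : ℝ) := ⟨_, rfl⟩
  have ha3 : a ^ 3 = K := by rw [ha, Real.rpow_third_pow_three (by linarith)]
  have hu3 : u ^ 3 = M := by rw [hu, Real.rpow_third_pow_three (by linarith)]
  have ht3 : t ^ 3 = T := by rw [ht, Real.rpow_third_pow_three (by linarith)]
  have hl3 : l ^ 3 = L := by rw [hl, Real.rpow_third_pow_three (by linarith)]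
  have hd3 : d ^ 3 = 4 / 3 * (M + 1) := by rw [hd, Real.rpow_third_pow_three (by linarith)]
  have ha1 : 1 ≤ a := by rw [ha]; exact Real.one_le_rpow hK (by norm_num)
  have hu1 : 1 ≤ u := by rw [hu]; exact Real.one_le_rpow hM (by norm_num)
  have hat : a ≤ t := by rw [ha, ht]; exact Real.rpow_le_rpow (by linarith) hKT (by norm_num)
  have hud : u ≤ d := by
    rw [hu, hd]; exact Real.rpow_le_rpow (by linarith) (by linarith) (by norm_num)
  have hl0 : 0 < l := by rw [hl]; exact Real.rpow_pos_of_pos (by linarith) _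
  have hlhalf : 1 / 2 ≤ l := by
    refine le_of_pow_le_pow_left₀ three_ne_zero hl0.le ?_
    rw [hl3]; linarith
  -- For `M ≥ 1`, `4/3 * (M + 1) ≤ 8/3 * M ≤ (3/2) ^ 3 * M`.
  have hdu : d ≤ 3 / 2 * u := by
    refine le_of_pow_le_pow_left₀ three_ne_zero (by linarith) ?_
    rw [mul_pow, hd3, hu3]; linarith
  have hx : (4 / 3 * (M + 1)) ^ (2 / 3 : ℝ) * T ^ (2 / 3 : ℝ) * L ^ (1 / 3 : ℝ) /
      (2 * (K * M) ^ (2 / 3 : ℝ)) = d ^ 2 * t ^ 2 * l / (2 * (a * u) ^ 2) := by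
    rw [Real.rpow_two_thirds hδ0, Real.rpow_two_thirds hT0,
      Real.rpow_two_thirds (x := K * M) (by positivity),
      Real.mul_rpow (x := K) (y := M) (by linarith) (by linarith), ← hd, ← ht, ← hl, ← ha, ← hu]
  rw [CETC.explorationLength, hx] at hm
  set x := d ^ 2 * t ^ 2 * l / (2 * (a * u) ^ 2) with hxdef
  have ha0 : 0 < a := by linarith
  have hu0 : 0 < u := by linarith
  have ht0 : 0 < t := by linarith
  have hd0 : 0 < d := by linarith
  have hx0 : 0 < x := by positivity
  have hxm : x ≤ m := by rw [hm]; exact Nat.le_ceil x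
  have hmx : (m : ℝ) ≤ x + 1 := by rw [hm]; exact (Nat.ceil_lt_add_one hx0.le).le
  have hm0 : (0 : ℝ) < m := hx0.trans_le hxm
  refine ⟨by exact_mod_cast hm0, ?_⟩
  have hsq : √(L / m) ≤ 2 * (a * l / t) := by
    rw [Real.sqrt_le_left (by positivity)]
    calc L / m ≤ L / x := by gcongr
      _ = 2 * (a * l / t) ^ 2 * (u ^ 2 / d ^ 2) := by
        rw [← hl3, hxdef]; field_simp
      _ ≤ 2 * (a * l / t) ^ 2 * 1 := by
        gcongr
        rw [div_le_one (by positivity)]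
        gcongr
      _ ≤ (2 * (a * l / t)) ^ 2 := by rw [mul_pow]; nlinarith [sq_nonneg (a * l / t)]
  have hexp : Real.exp (-2 * m * √(L / m) ^ 2) = 1 / T ^ 2 := by
    rw [Real.sq_sqrt (by positivity), show -2 * m * (L / m) = -(L + L) by field_simp; ring,
      Real.exp_neg, Real.exp_add, hexpL, one_div, sq]
  have hR : K ^ (1 / 3 : ℝ) * M * T ^ (2 / 3 : ℝ) * L ^ (1 / 3 : ℝ) = a * u ^ 3 * t ^ 2 * l := by
    rw [Real.rpow_two_thirds hT0, ← ha, ← ht, ← hl, hu3]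
  rw [hexp, hR]
  set R := a * u ^ 3 * t ^ 2 * l with hRdef
  have b1 : K * M * x ≤ 9 / 8 * R := by
    calc K * M * x = a * u * t ^ 2 * l / 2 * d ^ 2 := by
          rw [← ha3, ← hu3, hxdef]; field_simp
      _ ≤ a * u * t ^ 2 * l / 2 * (3 / 2 * u) ^ 2 := by gcongr
      _ = 9 / 8 * R := by rw [hRdef]; ring
  have b2 : K * M ≤ 2 * R := by
    calc K * M = a * u ^ 3 * a ^ 2 * 1 := by rw [← ha3, ← hu3]; ring
      _ ≤ a * u ^ 3 * t ^ 2 * (2 * l) := by gcongr; linarith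
      _ = 2 * R := by rw [hRdef]; ring
  have b3 : T * (4 / 3 * M * √(L / m)) ≤ 8 / 3 * R := by
    calc T * (4 / 3 * M * √(L / m)) ≤ T * (4 / 3 * M * (2 * (a * l / t))) := by gcongr
      _ = 8 / 3 * R := by rw [← ht3, ← hu3, hRdef]; field_simp; norm_num
  have b4 : T * (K * M * (2 * (1 / T ^ 2))) ≤ 4 * R := by
    calc T * (K * M * (2 * (1 / T ^ 2))) = K * M * 2 / T := by field_simp
      _ ≤ 2 * R * 2 / 1 := by gcongr; linarith
      _ = 4 * R := by ring
  have b5 : 0 ≤ R := by positivity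
  have b6 : K * M * m ≤ K * M * x + K * M := by
    calc K * M * m ≤ K * M * (x + 1) := by gcongr
      _ = _ := by ring
  rw [mul_add]
  linarith

theorem mainTheorem5 :
    ∃ C : ℝ, 0 < C ∧
      ∀ (n k M T : ℕ), 2 ≤ k →
      ∀ (𝓜 : Matroid (Fin n)), 𝓜.E = Set.univ → 𝓜.eRank = M →
      ∀ (c : GreedyChoices n k)
        {Ω : Type*} [MeasurableSpace Ω] (μ : Measure Ω) [IsProbabilityMeasure μ]
        (F : ℕ → Ω → PartialAssignment n k → ℝ) (f : PartialAssignment n k → ℝ),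
        IsStochasticReward μ F f →
        PartialAssignment.IsKSubmodular f →
        (n * k : ℝ) * max 1 (3 * √2 * M / (2 * (M + 1))) ≤ T →
        BanditPolicy.expectedRegret μ (1 / 3) {x | PartialAssignment.Feasible 𝓜 x} f F T
            (CETC.cetc (4 / 3 * (M + 1)) (n * k * M) T (MatroidGreedy.algorithm 𝓜 c M))
          ≤ C * (n : ℝ) ^ (1 / 3 : ℝ) * (k : ℝ) ^ (1 / 3 : ℝ) * M
              * (T : ℝ) ^ (2 / 3 : ℝ) * Real.log T ^ (1 / 3 : ℝ) := by
  refine ⟨10, by norm_num, ?_⟩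
  intro n k M T hk 𝓜 _ hM c Ω _ μ _ F f hF hf hT
  let _ : MeasurableSpace (PartialAssignment n k) := ⊤
  have : DiscreteMeasurableSpace (PartialAssignment n k) := ⟨fun _ => trivial⟩
  have hf0 := fun x => (hF.mean_mem_Icc x).1
  have hv : 1 / 3 * sSup (f '' {x | PartialAssignment.Feasible 𝓜 x}) ≤ 1 := by
    have : sSup (f '' {x | PartialAssignment.Feasible 𝓜 x}) ≤ 1 := by
      refine Real.sSup_le ?_ zero_le_one
      rintro _ ⟨x, -, rfl⟩
      exact (hF.mean_mem_Icc x).2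
    linarith
  set m := CETC.explorationLength (4 / 3 * (M + 1)) (n * k * M) T with hm
  have hKT : (n * k : ℝ) ≤ T := by
    refine le_trans ?_ hT
    exact le_mul_of_one_le_right (by positivity) (le_max_left _ _)
  have key := fun (hQ : 0 < n * k * M → 0 < m) => hF.expectedRegret_le (T := T)
    (ε := √(Real.log T / m)) (η := 4 / 3 * M * √(Real.log T / m))
    (Real.sqrt_nonneg _) (by positivity) hQ hv
    (MatroidGreedy.measurable_action_algorithm (𝓜 := 𝓜) (c := c) (m := m) M)
    (MatroidGreedy.guarantees_algorithm hf hf0 hk hM (Real.sqrt_nonneg _))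
  -- For rank `0` there are no queries and no offline error, so both bounds vanish. Otherwise the
  -- rank forces `n ≥ 1`, hence `T ≥ n * k ≥ 2`, which keeps `log T` away from `0`.
  rcases Nat.eq_zero_or_pos M with rfl | hM0
  · refine (key (by simp)).trans ?_
    simp
  · have hn : 1 ≤ n := by
      rcases Nat.eq_zero_or_pos n with rfl | hn
      · have := 𝓜.eRank_le_encard_ground
        rw [hM, Set.eq_empty_of_isEmpty 𝓜.E] at this
        simp at this
        omega
      · exact hn
    have hn' : (1 : ℝ) ≤ n := by exact_mod_cast hn
    have hk' : (2 : ℝ) ≤ k := by exact_mod_cast hk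
    obtain ⟨hm0, hle⟩ := CETC.regret_arith (K := n * k) (M := M) (T := T) (by nlinarith)
      (by exact_mod_cast hM0) hKT (by nlinarith) hm
    refine (key fun _ => hm0).trans ?_
    push_cast
    refine hle.trans_eq ?_
    rw [Real.mul_rpow (by positivity) (by positivity)]
    ring
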